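/- Fix $T\ge 0$, let $\Omega=D^+[0,T]$ be the set of all càdlàg functions $\omega:[0,T]\to[0,\infty)$, let $\mathcal F^\circ_t$ be the $\sigma$-algebra on $\Omega$ generated by the evaluations $\omega\mapsto\omega(s)$, $s\le t$, and let $\mathcal F_t$ be the universal completion of $\mathcal F^\circ_t$. A simple trading strategy $G$ consists of an initial capital $c\in\mathbb R$, stopping times $\tau_1\le\tau_2\le\cdots$ with values in $[0,T]\cup\{\infty\}$ with respect to $(\mathcal F_t)$, only finitely many of which are finite for each $\omega\in\Omega$, and bounded $\mathcal F_{\tau_n}$-measurable functions $h_n:\Omega\to\mathbb R$, $n\ge1$. Its simple capital process is $$\mathcal K^G_t(\omega)=c+\sum_{n=1}^\infty h_n(\omega)\bigl(\omega(\tau_{n+1}\wedge t)-\omega(\tau_n\wedge t)\bigr),\qquad t\in[0,T].$$ A positive capital process is a family $S=(S_t)_{t\in[0,T]}$ of $\mathcal F_t$-measurable functions $S_t:\Omega\to[-\infty,\infty]$ of the form $S_t(\omega)=\sum_{m=1}^\infty\mathcal K^{G_m}_t(\omega)$, where all $\mathcal K^{G_m}_t(\omega)$ are $\ge0$ and the sum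 of the initial capitals of the $G_m$ converges; the value $\infty$ is allowed. For $p>0$ and $f:[0,T]\to\mathbb R$ put $$\mathrm{var}_p(f)=\sup\sum_{i=1}^n|f(t_i)-f(t_{i-1})|^p\in[0,\infty],$$ the supremum being over all $n\ge1$ and all $0=t_0\le t_1\le\cdots\le t_n=T$. Proposition. Let $\epsilon>0$ and $\delta>0$. There is a positive capital process $S$ such that $S_0=1$ and, for all $\omega\in\Omega$, $$S_T(\omega)>(1-2^{-\epsilon})(1-2^{-\delta})\,2^{-6-\epsilon-\delta}\,\frac{\mathrm{var}_{2+\epsilon}(\omega)}{(1\vee\sup\omega)^{2+\epsilon+\delta}}-\frac14\quad\text{if }\mathrm{var}_{2+\epsilon}(\omega)<\infty,$$ and $S_T(\omega)=\infty$ if $\mathrm{var}_{2+\epsilon}(\omega)=\infty$. -/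

import Mathlib

open MeasureTheory Set Filter Topology
open scoped ENNReal

/-- A path in `D⁺[0,T]`: a function `[0,T] → [0,∞)` that is right-continuous and has (finite)
left limits. At the right end point the first condition is void, at the left end point the second
one is. -/
structure PricePath (T : ℝ) where
  toFun : Icc (0 : ℝ) T → ℝ
  nonneg' : ∀ t, 0 ≤ toFun t
  rightCont' : ∀ t, ContinuousWithinAt toFun (Ioi t) t
  leftLim' : ∀ t, ∃ l : ℝ, Tendsto toFun (𝓝[<] t) (𝓝 l)

namespace PricePath

instance (T : ℝ) : CoeFun (PricePath T) (fun _ => Icc (0 : ℝ) T → ℝ) := ⟨PricePath.toFun⟩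

/-- Paths in `D⁺[0,T]` are bounded, so that the real supremum below is the true one. -/
theorem bddAbove_range {T : ℝ} (ω : PricePath T) : BddAbove (range ω) := by
  have key : ∀ t : Icc (0 : ℝ) T, ∃ s ∈ 𝓝 t, BddAbove (ω '' s) := by
    intro t
    obtain ⟨l, hl⟩ := ω.leftLim' t
    have h1 : ∀ᶠ s in 𝓝[<] t, ω s ≤ l + 1 := hl.eventually (eventually_le_nhds (by linarith))
    have h2 : ∀ᶠ s in 𝓝[>] t, ω s ≤ ω t + 1 :=
      (ω.rightCont' t).eventually (eventually_le_nhds (by linarith))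
    rw [eventually_nhdsWithin_iff] at h1 h2
    refine ⟨_, h1.and h2, max (l + 1) (ω t + 1), ?_⟩
    rintro _ ⟨s, ⟨hs1, hs2⟩, rfl⟩
    rcases lt_trichotomy s t with h | h | h
    · exact (hs1 h).trans (le_max_left _ _)
    · subst h
      exact le_trans (by linarith) (le_max_right _ _)
    · exact (hs2 h).trans (le_max_right _ _)
  have h : BddAbove (ω '' univ) := by
    refine isCompact_univ.induction_on (p := fun s => BddAbove (ω '' s)) (by simp)
      (fun s t hst ht => ht.mono (image_mono hst)) (fun s t hs ht => ?_) (fun t _ => ?_)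
    · rw [image_union]
      exact hs.union ht
    · obtain ⟨s, hs, hb⟩ := key t
      exact ⟨s, mem_nhdsWithin_of_mem_nhds hs, hb⟩
  rwa [image_univ] at h

/-- `sup ω`, the supremum of the path over `[0,T]`. -/
noncomputable def sup {T : ℝ} (ω : PricePath T) : ℝ := ⨆ t, ω t

end PricePath

/-- The universal completion of a σ-algebra `m`: the sets that are measurable with respect to the
completion of every probability measure on `m`. -/
@[reducible] def universalCompletion {Ω : Type*} (m : MeasurableSpace Ω) : MeasurableSpace Ω where
  MeasurableSet' s := ∀ μ : @Measure Ω m, @IsProbabilityMeasure Ω m μ → @NullMeasurableSet Ω m s μ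
  measurableSet_empty _ _ := nullMeasurableSet_empty
  measurableSet_compl _ hs μ hμ := (hs μ hμ).compl
  measurableSet_iUnion _ hf μ hμ := NullMeasurableSet.iUnion fun i => hf i μ hμ

theorem universalCompletion_mono {Ω : Type*} {m₁ m₂ : MeasurableSpace Ω} (h : m₁ ≤ m₂) :
    universalCompletion m₁ ≤ universalCompletion m₂ := by
  intro s hs μ hμ
  have hs' := hs (μ.trim h) ⟨by rw [trim_measurableSet_eq h MeasurableSet.univ, hμ.measure_univ]⟩
  obtain ⟨t, -, ht, hts⟩ :=
    @NullMeasurableSet.exists_measurable_superset_ae_eq Ω m₁ (μ.trim h) s hs'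
  exact ⟨t, h t ht, (ae_eq_of_ae_eq_trim hts).symm⟩

/-- `𝓕°_t`: the σ-algebra generated by the evaluations `ω ↦ ω(s)`, `s ≤ t`. -/
@[reducible] def rawSigma (T : ℝ) (t : Icc (0 : ℝ) T) : MeasurableSpace (PricePath T) :=
  ⨆ s : {s : Icc (0 : ℝ) T // s ≤ t}, MeasurableSpace.comap (fun ω => ω s.1) (borel ℝ)

/-- The filtration `(𝓕_t)`, where `𝓕_t` is the universal completion of `𝓕°_t`. The ambient
σ-algebra is the universal completion of the one generated by all evaluations. -/
def pathFiltration (T : ℝ) :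
    Filtration (Icc (0 : ℝ) T) (universalCompletion (⨆ t, rawSigma T t)) where
  seq t := universalCompletion (rawSigma T t)
  mono' := fun _ t hst => universalCompletion_mono <|
    iSup_le fun r => le_iSup (fun r : {r : Icc (0 : ℝ) T // r ≤ t} =>
      MeasurableSpace.comap (fun ω : PricePath T => ω r.1) (borel ℝ)) ⟨r.1, r.2.trans hst⟩
  le' := fun t => universalCompletion_mono (le_iSup (rawSigma T) t)

/-- A simple trading strategy: an initial capital, an increasing sequence of stopping times with
values in `[0,T] ∪ {∞}`, only finitely many of them finite on each path, and bounded positions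
`h n`, measurable with respect to the σ-algebra of the `n`-th stopping time. -/
structure SimpleStrategy (T : ℝ) where
  initial : ℝ
  τ : ℕ → PricePath T → WithTop (Icc (0 : ℝ) T)
  isStoppingTime : ∀ n, IsStoppingTime (pathFiltration T) (τ n)
  mono : ∀ n ω, τ n ω ≤ τ (n + 1) ω
  finite : ∀ ω, {n | τ n ω ≠ ⊤}.Finite
  h : ℕ → PricePath T → ℝ
  measurable_h : ∀ n, Measurable[(isStoppingTime n).measurableSpace] (h n)
  bounded_h : ∀ n, ∃ C : ℝ, ∀ ω, |h n ω| ≤ C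

/-- The time `τ ∧ t`, for `τ ∈ [0,T] ∪ {∞}` and `t ∈ [0,T]`. -/
def capTime {T : ℝ} (τ : WithTop (Icc (0 : ℝ) T)) (t : Icc (0 : ℝ) T) : Icc (0 : ℝ) T :=
  min (τ.untopD t) t

/-- The simple capital process of a simple trading strategy. The terms with `τ n ω = ∞` vanish,
so the sum has only finitely many nonzero terms. -/
noncomputable def SimpleStrategy.capital {T : ℝ} (G : SimpleStrategy T) (t : Icc (0 : ℝ) T)
    (ω : PricePath T) : ℝ :=
  G.initial + ∑ᶠ n, G.h n ω * (ω (capTime (G.τ (n + 1) ω) t) - ω (capTime (G.τ n ω) t))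

/-- The sum in `SimpleStrategy.capital` is a genuine finite sum. -/
theorem SimpleStrategy.finite_support {T : ℝ} (G : SimpleStrategy T) (t : Icc (0 : ℝ) T)
    (ω : PricePath T) : (Function.support fun n =>
      G.h n ω * (ω (capTime (G.τ (n + 1) ω) t) - ω (capTime (G.τ n ω) t))).Finite := by
  refine (G.finite ω).subset fun n hn htop => hn ?_
  have h1 : G.τ (n + 1) ω = ⊤ := top_le_iff.1 (htop ▸ G.mono n ω)
  simp [htop, h1]

/-- A process: an adapted family of functions `S t : Ω → [-∞,∞]`. -/
def IsProcess {T : ℝ} (S : Icc (0 : ℝ) T → PricePath T → EReal) : Prop :=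
  ∀ t, Measurable[pathFiltration T t] (S t)

/-- A positive capital process: a process that is the sum of a sequence of positive (in the sense
of `≥ 0`) simple capital processes whose initial capitals have a convergent sum. The values may be
`∞`. -/
def IsPositiveCapitalProcess {T : ℝ} (S : Icc (0 : ℝ) T → PricePath T → EReal) : Prop :=
  IsProcess S ∧ ∃ G : ℕ → SimpleStrategy T,
    (∀ m t ω, 0 ≤ (G m).capital t ω) ∧
    Summable (fun m => (G m).initial) ∧
    ∀ t ω, S t ω = ((∑' m, ENNReal.ofReal ((G m).capital t ω) : ℝ≥0∞) : EReal)

/-- The `p`-variation of `f : [0,T] → ℝ`, with values in `[0,∞]`: the supremum over `n ≥ 1` and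
the partitions `0 = t 0 ≤ t 1 ≤ ⋯ ≤ t n = T`. (The sequence `t` is constant after `n`.) -/
noncomputable def pVar {T : ℝ} (p : ℝ) (f : Icc (0 : ℝ) T → ℝ) : ℝ≥0∞ :=
  ⨆ (n : ℕ) (t : ℕ → Icc (0 : ℝ) T)
    (_ : 0 < n ∧ Monotone t ∧ (t 0 : ℝ) = 0 ∧ (t n : ℝ) = T),
    ∑ i ∈ Finset.range n, ENNReal.ofReal (|f (t (i + 1)) - f (t i)| ^ p)

/-!
The capital process is a countable sum of elementary strategies of "buy low, sell high" type.

*One band.* A trader who buys one unit when the price is at most `α` and sells it when the price is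
at least `β > α ≥ 0` needs an initial capital of only `α`: the unit held is never worth less than
`0`. Every completed cycle earns at least `β - α`, so twice the capital bounds `β - α` times the
number of changes of position, up to one change (`bandExcess_succ`, `sum_abs_bandPosition_sub_le`).

*Trading times.* Whether a càdlàg path has been at most `α` by time `t` depends on uncountably many
evaluations, since the level `α` may be approached by left limits only. All trading therefore takes
place at the successive times at which the oscillation of the path since the previous time reaches a
level `η` (`oscTime`). By right continuity these can be described by countably many evaluations and
are stopping times (`isStoppingTime_nextOscTime`); by the existence of left limits only finitely
many of them are finite (`finite_oscTime_ne_top`). In between, the path stays within `η` of its last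
sampled value, so an increment of the path across `[α - η, β + η]` forces a change of the position.

*Grids.* For paths bounded by `u = 2 ^ L`, the bands of the `j`-th level have width
`ℓ = u / 2 ^ (j + 2)` and `η = ℓ / 5`. An increment of absolute value `d ∈ (2ℓ, 4ℓ]` crosses at
least one band, and at least two if `d ≥ 3ℓ`; hence `16/9 * d ^ p` is at most `(4ℓ) ^ p` times the
number of crossings (`rpow_abs_sub_le_crossCount`). The factor `16/9` compensates for earning only
`3/5 * ℓ` per cycle. The initial capital is distributed over `L` and `j` by geometric sequences with
ratios `2 ^ (-δ)` and `2 ^ (-ε)`; the latter makes the earnings per crossing at level `j`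
proportional to `2 ^ (-(2 + ε) * j)`, as the variation requires. Summing over the levels bounds the
variation along every partition by the final capital plus `3/20` (`variationCoeff_mul_pVar_le`), and
`L` is chosen with `1 ∨ sup ω < 2 ^ L ≤ 2 * (1 ∨ sup ω)`.
-/

/-! ### Right continuity and countable dense sets of times -/

theorem PricePath.exists_gt_near {T : ℝ} (ω : PricePath T) {s t : Icc (0 : ℝ) T} (hst : s < t)
    {κ : ℝ} (hκ : 0 < κ) :
    ∃ v, s < v ∧ v ≤ t ∧ ∀ r, s ≤ r → r < v → |ω r - ω s| < κ := by
  have h : {r | |ω r - ω s| < κ} ∈ 𝓝[>] s := by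
    have := (ω.rightCont' s).eventually (Metric.ball_mem_nhds (ω s) hκ)
    exact this.mono fun r hr => by simpa [Real.dist_eq] using hr
  obtain ⟨u, hu, hsub⟩ := (mem_nhdsGT_iff_exists_Ioo_subset' hst).1 h
  refine ⟨min u t, lt_min hu hst, min_le_right _ _, fun r hr hrv => ?_⟩
  rcases hr.eq_or_lt with rfl | hr
  · simpa using hκ
  · exact hsub ⟨hr, hrv.trans_le (min_le_left _ _)⟩

theorem PricePath.exists_mem_dense_near {T : ℝ} (ω : PricePath T) {D : Set (Icc (0 : ℝ) T)}
    (hD : Dense D) {s t : Icc (0 : ℝ) T} (hst : s ≤ t) {κ : ℝ} (hκ : 0 < κ) :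
    ∃ r ∈ insert t D, s ≤ r ∧ r ≤ t ∧ |ω r - ω s| < κ := by
  rcases hst.eq_or_lt with rfl | hst
  · exact ⟨s, mem_insert _ _, le_rfl, le_rfl, by simpa using hκ⟩
  · obtain ⟨v, hsv, hvt, hv⟩ := ω.exists_gt_near hst hκ
    obtain ⟨r, hrD, hsr, hrv⟩ := hD.exists_between hsv
    exact ⟨r, mem_insert_of_mem _ hrD, hsr.le, hrv.le.trans hvt, hv r hsr.le hrv⟩

theorem measurable_eval {T : ℝ} {s t : Icc (0 : ℝ) T} (hst : s ≤ t) :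
    Measurable[pathFiltration T t] fun ω : PricePath T => ω s := by
  intro B hB μ hμ
  have hraw : MeasurableSet[rawSigma T t] ((fun ω : PricePath T => ω s) ⁻¹' B) :=
    le_iSup (fun r : {r : Icc (0 : ℝ) T // r ≤ t} =>
      MeasurableSpace.comap (fun ω : PricePath T => ω r.1) (borel ℝ)) ⟨s, hst⟩ _
      ⟨B, (BorelSpace.measurable_eq (α := ℝ)) ▸ hB, rfl⟩
  exact hraw.nullMeasurableSet

theorem capTime_coe {T : ℝ} {s t : Icc (0 : ℝ) T} (h : s ≤ t) :
    capTime (s : WithTop (Icc (0 : ℝ) T)) t = s :=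
  min_eq_left h

theorem capTime_of_ge {T : ℝ} {σ : WithTop (Icc (0 : ℝ) T)} {t : Icc (0 : ℝ) T} (h : t ≤ σ) :
    capTime σ t = t := by
  induction σ with
  | top => exact min_self t
  | coe s => exact min_eq_right (WithTop.coe_le_coe.1 h)

/-- Right continuity turns the value of the path at a stopping time into a countable expression
in the evaluations up to the current time. -/
theorem measurable_eval_capTime {T : ℝ} {σ : PricePath T → WithTop (Icc (0 : ℝ) T)}
    (hσ : IsStoppingTime (pathFiltration T) σ) (t : Icc (0 : ℝ) T) :
    Measurable[pathFiltration T t] fun ω : PricePath T => ω (capTime (σ ω) t) := by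
  obtain ⟨D, hDc, hD⟩ := TopologicalSpace.exists_countable_dense (Icc (0 : ℝ) T)
  have : Countable D := hDc
  refine @measurable_of_Iio ℝ (PricePath T) _ _ _ (pathFiltration T t) _ _ _ _ fun c => ?_
  -- If `σ ω < t`, the value at `σ ω` is below `c` iff for some `m` and some `q > σ ω` the path is
  -- at most `c - 1 / (m + 1)` at all times of `D` from `σ ω` to `q`.
  have heq : (fun ω : PricePath T => ω (capTime (σ ω) t)) ⁻¹' Iio c =
      ({ω | σ ω < t}ᶜ ∩ {ω | ω t < c}) ∪
      ⋃ m : ℕ, ⋃ q : {q : D // q.1 < t}, {ω | σ ω < (q.1.1 : Icc (0 : ℝ) T)} ∩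
        ⋂ r : {r : D // r.1 ≤ q.1.1}, ({ω | σ ω ≤ (r.1.1 : Icc (0 : ℝ) T)}ᶜ ∪
          {ω | ω r.1.1 ≤ c - 1 / ((m : ℝ) + 1)}) := by
    ext ω
    simp only [mem_preimage, mem_Iio, mem_union, mem_inter_iff, mem_compl_iff, mem_ofPred_eq,
      mem_iUnion, mem_iInter]
    by_cases hlt : σ ω < t
    · obtain ⟨s, hs⟩ := WithTop.ne_top_iff_exists.1 hlt.ne_top
      rw [← hs] at hlt ⊢
      have hst : s < t := WithTop.coe_lt_coe.1 hlt
      have hcap : capTime (s : WithTop (Icc (0 : ℝ) T)) t = s := capTime_coe hst.le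
      simp only [hcap, hlt, not_true_eq_false, false_and, false_or, WithTop.coe_lt_coe,
        WithTop.coe_le_coe]
      constructor
      · intro h
        obtain ⟨m, hm⟩ := exists_nat_one_div_lt (sub_pos.2 h)
        obtain ⟨v, hsv, hvt, hv⟩ := ω.exists_gt_near hst (sub_pos.2 hm)
        obtain ⟨q, hqD, hsq, hqv⟩ := hD.exists_between hsv
        refine ⟨m, ⟨⟨q, hqD⟩, hqv.trans_le hvt⟩, hsq, fun r => ?_⟩
        by_cases hr : s ≤ r.1.1
        · have := abs_lt.1 (hv _ hr (lt_of_le_of_lt r.2 hqv))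
          exact Or.inr (by linarith [this.2])
        · exact Or.inl hr
      · rintro ⟨m, q, hsq, hr⟩
        by_contra hc
        have hm : (0 : ℝ) < 1 / ((m : ℝ) + 1) := by positivity
        obtain ⟨v, hsv, hvq, hv⟩ := ω.exists_gt_near hsq hm
        obtain ⟨r, hrD, hsr, hrv⟩ := hD.exists_between hsv
        have h1 := (hr ⟨⟨r, hrD⟩, (hrv.trans_le hvq).le⟩).resolve_left (fun h => h hsr.le)
        have h2 := (abs_lt.1 (hv r hsr.le hrv)).1
        simp only at h1
        linarith
    · have hcap : capTime (σ ω) t = t := capTime_of_ge (not_lt.1 hlt)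
      simp only [hcap, hlt, not_false_eq_true, true_and]
      refine ⟨Or.inl, fun h => h.elim id ?_⟩
      rintro ⟨m, q, hq, -⟩
      exact absurd (hq.trans (WithTop.coe_lt_coe.2 q.2)) hlt
  rw [heq]
  have hmono := fun {s : Icc (0 : ℝ) T} (h : s ≤ t) => (pathFiltration T).mono h
  refine MeasurableSet.union ((hσ.measurableSet_lt t).compl.inter ?_) ?_
  · exact measurable_eval le_rfl measurableSet_Iio
  · refine MeasurableSet.iUnion fun m => MeasurableSet.iUnion fun q =>
      (hmono q.2.le _ (hσ.measurableSet_lt _)).inter (MeasurableSet.iInter fun r => ?_)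
    have hrt : (r.1.1 : Icc (0 : ℝ) T) ≤ t := le_trans r.2 q.2.le
    exact (hmono hrt _ (hσ _)).compl.union (measurable_eval hrt measurableSet_Iic)

/-! ### Oscillation times -/

/-- The oscillation of `f` over the times from `σ` to `t` is at least `η`. -/
def OscReaches {T : ℝ} (f : Icc (0 : ℝ) T → ℝ) (η : ℝ) (σ : WithTop (Icc (0 : ℝ) T))
    (t : Icc (0 : ℝ) T) : Prop :=
  ∀ η' < η, ∃ q r : Icc (0 : ℝ) T, σ ≤ q ∧ q ≤ t ∧ σ ≤ r ∧ r ≤ t ∧ η' < |f q - f r|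

open Classical in
/-- The first time at which the oscillation of `f` from time `σ` on reaches `η`; it is `⊤` if there
is no such time. -/
noncomputable def nextOscTime {T : ℝ} (f : Icc (0 : ℝ) T → ℝ) (η : ℝ)
    (σ : WithTop (Icc (0 : ℝ) T)) : WithTop (Icc (0 : ℝ) T) :=
  if h : ∃ t, IsLeast {t | OscReaches f η σ t} t then (h.choose : WithTop (Icc (0 : ℝ) T)) else ⊤

theorem OscReaches.mono {T : ℝ} {f : Icc (0 : ℝ) T → ℝ} {η : ℝ} {σ : WithTop (Icc (0 : ℝ) T)}
    {s t : Icc (0 : ℝ) T} (h : OscReaches f η σ s) (hst : s ≤ t) : OscReaches f η σ t := by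
  intro η' hη'
  obtain ⟨q, r, h1, h2, h3, h4, h5⟩ := h η' hη'
  exact ⟨q, r, h1, h2.trans hst, h3, h4.trans hst, h5⟩

theorem OscReaches.lt {T : ℝ} {f : Icc (0 : ℝ) T → ℝ} {η : ℝ} (hη : 0 < η)
    {σ : WithTop (Icc (0 : ℝ) T)} {t : Icc (0 : ℝ) T} (h : OscReaches f η σ t) : σ < t := by
  obtain ⟨q, r, h1, h2, h3, h4, h5⟩ := h 0 hη
  refine lt_of_le_of_ne (h1.trans (WithTop.coe_le_coe.2 h2)) fun he => ?_
  rw [he, WithTop.coe_le_coe] at h1 h3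
  rw [le_antisymm h2 h1, le_antisymm h4 h3] at h5
  simp at h5

/-- By right continuity the oscillation reaches its level at a first time. -/
theorem PricePath.exists_isLeast_oscReaches {T : ℝ} (ω : PricePath T) {η : ℝ} (hη : 0 < η)
    {σ : WithTop (Icc (0 : ℝ) T)} {t : Icc (0 : ℝ) T} (ht : OscReaches ω η σ t) :
    ∃ t, IsLeast {t | OscReaches ω η σ t} t := by
  set A := {t | OscReaches ω η σ t} with hA
  obtain ⟨t₀, ht₀, hlb⟩ := (isClosed_closure (s := A)).isCompact.exists_isLeast
    ⟨t, subset_closure ht⟩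
  have hlb' : t₀ ∈ lowerBounds A := fun a ha => hlb (subset_closure ha)
  refine ⟨t₀, ?_, hlb'⟩
  by_contra hnot
  have hlt : ∀ a ∈ A, t₀ < a := fun a ha => (hlb' ha).lt_of_ne fun h => hnot (h ▸ ha)
  obtain ⟨s, rfl⟩ := WithTop.ne_top_iff_exists.1 (OscReaches.lt hη ht).ne_top
  have hst₀ : s ≤ t₀ := by
    have : closure A ⊆ Ici s := closure_minimal
      (fun a ha => WithTop.coe_le_coe.1 (OscReaches.lt hη ha).le) isClosed_Ici
    exact this ht₀
  have hnot' := hnot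
  simp only [hA, mem_ofPred_eq, OscReaches, not_forall, not_exists] at hnot'
  obtain ⟨η', hη', hosc⟩ := hnot'
  have hosc' : ∀ q r : Icc (0 : ℝ) T, s ≤ q → q ≤ t₀ → s ≤ r → r ≤ t₀ → |ω q - ω r| ≤ η' := by
    intro q r h1 h2 h3 h4
    by_contra h5
    exact hosc q r ⟨WithTop.coe_le_coe.2 h1, h2, WithTop.coe_le_coe.2 h3, h4, not_le.1 h5⟩
  have hκ : 0 < (η - η') / 3 := by linarith
  obtain ⟨v, htv, -, hv⟩ := ω.exists_gt_near (hlt t ht) hκ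
  obtain ⟨a, hav, haA⟩ := mem_closure_iff.1 ht₀ (Iio v) isOpen_Iio htv
  -- a point of the interval is within `(η - η') / 3` of one that is not after `t₀`
  have hnear : ∀ q, s ≤ q → q ≤ a →
      ∃ q', s ≤ q' ∧ q' ≤ t₀ ∧ |ω q - ω q'| < (η - η') / 3 := by
    intro q h1 h2
    rcases le_total q t₀ with h | h
    · exact ⟨q, h1, h, by simpa using hκ⟩
    · exact ⟨t₀, hst₀, le_rfl, hv q h (lt_of_le_of_lt h2 hav)⟩
  obtain ⟨q, r, h1, h2, h3, h4, h5⟩ := haA (η' + 2 * ((η - η') / 3)) (by linarith)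
  obtain ⟨q', hq1, hq2, hq3⟩ := hnear q (WithTop.coe_le_coe.1 h1) h2
  obtain ⟨r', hr1, hr2, hr3⟩ := hnear r (WithTop.coe_le_coe.1 h3) h4
  have h6 := hosc' q' r' hq1 hq2 hr1 hr2
  have e1 := abs_sub_le (ω q) (ω q') (ω r)
  have e2 := abs_sub_le (ω q') (ω r') (ω r)
  rw [abs_sub_comm (ω r') (ω r)] at e2
  linarith

theorem PricePath.nextOscTime_le_iff {T : ℝ} (ω : PricePath T) {η : ℝ} (hη : 0 < η)
    {σ : WithTop (Icc (0 : ℝ) T)} {t : Icc (0 : ℝ) T} :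
    nextOscTime ω η σ ≤ t ↔ OscReaches ω η σ t := by
  unfold nextOscTime
  split_ifs with h
  · rw [WithTop.coe_le_coe]
    exact ⟨fun hle => OscReaches.mono h.choose_spec.1 hle, fun ht => h.choose_spec.2 ht⟩
  · exact ⟨fun hle => absurd hle (by simp), fun ht => absurd (ω.exists_isLeast_oscReaches hη ht) h⟩

theorem isStoppingTime_nextOscTime {T : ℝ} {η : ℝ} (hη : 0 < η)
    {σ : PricePath T → WithTop (Icc (0 : ℝ) T)} (hσ : IsStoppingTime (pathFiltration T) σ) :
    IsStoppingTime (pathFiltration T) fun ω => nextOscTime ω η (σ ω) := by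
  intro t
  obtain ⟨D, hDc, hD⟩ := TopologicalSpace.exists_countable_dense (Icc (0 : ℝ) T)
  have : Countable (insert t D : Set (Icc (0 : ℝ) T)) := (hDc.insert t).to_subtype
  have heq : {ω : PricePath T | nextOscTime ω η (σ ω) ≤ t} =
      ⋂ m : ℕ, ⋃ q : {q : (insert t D : Set (Icc (0 : ℝ) T)) // q.1 ≤ t},
        ⋃ r : {r : (insert t D : Set (Icc (0 : ℝ) T)) // r.1 ≤ t},
          {ω | σ ω ≤ (q.1.1 : Icc (0 : ℝ) T)} ∩ {ω | σ ω ≤ (r.1.1 : Icc (0 : ℝ) T)} ∩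
            {ω | η - 1 / ((m : ℝ) + 1) < |ω q.1.1 - ω r.1.1|} := by
    ext ω
    simp only [mem_ofPred_eq, ω.nextOscTime_le_iff hη, mem_iInter, mem_iUnion, mem_inter_iff]
    constructor
    · intro h m
      have hm : (0 : ℝ) < 1 / ((m : ℝ) + 1) := by positivity
      obtain ⟨q, r, h1, h2, h3, h4, h5⟩ := h (η - 1 / ((m : ℝ) + 1)) (by linarith)
      have hκ : 0 < (|ω q - ω r| - (η - 1 / ((m : ℝ) + 1))) / 2 := by linarith
      obtain ⟨q', hq0, hq1, hq2, hq3⟩ := ω.exists_mem_dense_near hD h2 hκ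
      obtain ⟨r', hr0, hr1, hr2, hr3⟩ := ω.exists_mem_dense_near hD h4 hκ
      refine ⟨⟨⟨q', hq0⟩, hq2⟩, ⟨⟨r', hr0⟩, hr2⟩,
        ⟨h1.trans (WithTop.coe_le_coe.2 hq1), h3.trans (WithTop.coe_le_coe.2 hr1)⟩, ?_⟩
      have e1 := abs_sub_le (ω q) (ω q') (ω r)
      have e2 := abs_sub_le (ω q') (ω r') (ω r)
      rw [abs_sub_comm (ω q) (ω q')] at e1
      simp only
      linarith
    · intro h η' hη'
      obtain ⟨m, hm⟩ := exists_nat_one_div_lt (sub_pos.2 hη')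
      obtain ⟨q, r, ⟨h1, h2⟩, h3⟩ := h m
      exact ⟨q.1.1, r.1.1, h1, q.2, h2, r.2, by linarith⟩
  rw [heq]
  refine MeasurableSet.iInter fun m => MeasurableSet.iUnion fun q => MeasurableSet.iUnion fun r =>
    (((pathFiltration T).mono q.2 _ (hσ _)).inter ((pathFiltration T).mono r.2 _ (hσ _))).inter ?_
  exact (continuous_abs.measurable.comp ((measurable_eval q.2).sub (measurable_eval r.2)))
    measurableSet_Ioi

/-- The times at which the path is sampled: time `0`, and then each time the first moment at which
the oscillation since the previous sampling time reaches `η`. -/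
noncomputable def oscTime {T : ℝ} (hT : 0 ≤ T) (η : ℝ) : ℕ → PricePath T → WithTop (Icc (0 : ℝ) T)
  | 0, _ => ((⟨0, left_mem_Icc.2 hT⟩ : Icc (0 : ℝ) T) : WithTop (Icc (0 : ℝ) T))
  | n + 1, ω => nextOscTime ω η (oscTime hT η n ω)

theorem isStoppingTime_oscTime {T : ℝ} (hT : 0 ≤ T) {η : ℝ} (hη : 0 < η) (n : ℕ) :
    IsStoppingTime (pathFiltration T) (oscTime hT η n) := by
  induction n with
  | zero => exact isStoppingTime_const _ _
  | succ n ih => exact isStoppingTime_nextOscTime hη ih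

theorem oscTime_lt_succ {T : ℝ} (hT : 0 ≤ T) {η : ℝ} (hη : 0 < η) (n : ℕ) (ω : PricePath T)
    {t : Icc (0 : ℝ) T} (h : oscTime hT η (n + 1) ω ≤ t) :
    oscTime hT η n ω < oscTime hT η (n + 1) ω := by
  obtain ⟨s, hs⟩ := WithTop.ne_top_iff_exists.1 (ne_top_of_le_ne_top WithTop.coe_ne_top h)
  rw [← hs]
  exact OscReaches.lt hη ((ω.nextOscTime_le_iff hη).1 hs.ge)

theorem oscTime_le_succ {T : ℝ} (hT : 0 ≤ T) {η : ℝ} (hη : 0 < η) (n : ℕ) (ω : PricePath T) :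
    oscTime hT η n ω ≤ oscTime hT η (n + 1) ω := by
  rcases h : oscTime hT η (n + 1) ω with _ | s
  · exact le_top
  · exact (h ▸ oscTime_lt_succ hT hη n ω (t := s) h.le).le

theorem monotone_oscTime {T : ℝ} (hT : 0 ≤ T) {η : ℝ} (hη : 0 < η) (ω : PricePath T) :
    Monotone fun n => oscTime hT η n ω :=
  monotone_nat_of_le_succ fun n => oscTime_le_succ hT hη n ω

/-- Sampling times accumulate nowhere because the path has left limits. -/
theorem exists_oscTime_eq_top {T : ℝ} (hT : 0 ≤ T) {η : ℝ} (hη : 0 < η) (ω : PricePath T) :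
    ∃ n, oscTime hT η n ω = ⊤ := by
  by_contra! hfin
  choose s hs using fun n => WithTop.ne_top_iff_exists.1 (hfin n)
  have hstrict : StrictMono s := strictMono_nat_of_lt_succ fun n => by
    have := oscTime_lt_succ hT hη n ω (hs (n + 1)).ge
    rwa [← hs, ← hs, WithTop.coe_lt_coe] at this
  obtain ⟨b, hb⟩ := (isClosed_closure (s := range s)).isCompact.exists_isLUB
    ⟨s 0, subset_closure (mem_range_self 0)⟩
  replace hb : IsLUB (range s) b := (isLUB_congr (upperBounds_closure _)).1 hb.2
  have hlim := tendsto_atTop_isLUB hstrict.monotone hb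
  have hlt : ∀ n, s n < b := fun n =>
    (hstrict n.lt_succ_self).trans_le (hb.1 (mem_range_self _))
  obtain ⟨l, hl⟩ := ω.leftLim' b
  have hmem : {r | |ω r - l| < η / 3} ∈ 𝓝[<] b := by
    have := hl.eventually (Metric.ball_mem_nhds l (by positivity : 0 < η / 3))
    exact this.mono fun r hr => by simpa [Real.dist_eq] using hr
  obtain ⟨v, hv, hsub⟩ := (mem_nhdsLT_iff_exists_Ioo_subset' (hlt 0)).1 hmem
  obtain ⟨n, hn⟩ := (hlim.eventually (lt_mem_nhds hv)).exists
  have hosc : OscReaches ω η (s n) (s (n + 1)) := by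
    rw [← ω.nextOscTime_le_iff hη, hs n, hs (n + 1)]
    exact le_rfl
  obtain ⟨q, r, h1, h2, h3, h4, h5⟩ := hosc (2 * (η / 3)) (by linarith)
  have hq : |ω q - l| < η / 3 :=
    hsub ⟨lt_of_lt_of_le hn (WithTop.coe_le_coe.1 h1), lt_of_le_of_lt h2 (hlt _)⟩
  have hr : |ω r - l| < η / 3 :=
    hsub ⟨lt_of_lt_of_le hn (WithTop.coe_le_coe.1 h3), lt_of_le_of_lt h4 (hlt _)⟩
  have e1 := abs_sub_le (ω q) l (ω r)
  rw [abs_sub_comm l] at e1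
  linarith

theorem finite_oscTime_ne_top {T : ℝ} (hT : 0 ≤ T) {η : ℝ} (hη : 0 < η) (ω : PricePath T) :
    {n | oscTime hT η n ω ≠ ⊤}.Finite := by
  obtain ⟨N, hN⟩ := exists_oscTime_eq_top hT hη ω
  refine (finite_Iio N).subset fun n hn => ?_
  by_contra hle
  exact hn (top_le_iff.1 (hN ▸ monotone_oscTime hT hη ω (not_lt.1 hle)))

/-- The index of the last sampling time that is not after `t`. -/
theorem exists_oscTime_le_lt {T : ℝ} (hT : 0 ≤ T) {η : ℝ} (hη : 0 < η) (ω : PricePath T)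
    (t : Icc (0 : ℝ) T) : ∃ n, oscTime hT η n ω ≤ t ∧ t < oscTime hT η (n + 1) ω := by
  classical
  obtain ⟨N, hN⟩ := exists_oscTime_eq_top hT hη ω
  have hex : ∃ n, (t : WithTop (Icc (0 : ℝ) T)) < oscTime hT η n ω :=
    ⟨N, by rw [hN]; exact WithTop.coe_lt_top _⟩
  have h0 : Nat.find hex ≠ 0 := fun h => by
    have := Nat.find_spec hex
    rw [h] at this
    exact absurd (WithTop.coe_lt_coe.1 this) (not_lt.2 t.2.1)
  obtain ⟨n, hn⟩ := Nat.exists_eq_succ_of_ne_zero h0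
  exact ⟨n, not_lt.1 (Nat.find_min hex (by omega)), by
    have := Nat.find_spec hex
    rwa [hn] at this⟩

theorem abs_sub_lt_of_lt_oscTime {T : ℝ} (hT : 0 ≤ T) {η : ℝ} (hη : 0 < η) (ω : PricePath T)
    {n : ℕ} {q r t : Icc (0 : ℝ) T} (ht : t < oscTime hT η (n + 1) ω)
    (hq : oscTime hT η n ω ≤ q) (hqt : q ≤ t) (hr : oscTime hT η n ω ≤ r) (hrt : r ≤ t) :
    |ω q - ω r| < η := by
  by_contra h
  exact ht.not_ge <| (ω.nextOscTime_le_iff hη).2 fun η' hη' =>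
    ⟨q, r, hq, hqt, hr, hrt, hη'.trans_le (not_lt.1 h)⟩

/-- The path at the `n`-th sampling time (and at time `T` if that time is infinite). -/
noncomputable def sample {T : ℝ} (hT : 0 ≤ T) (η : ℝ) (ω : PricePath T) (n : ℕ) : ℝ :=
  ω (capTime (oscTime hT η n ω) ⟨T, right_mem_Icc.2 hT⟩)

theorem eval_capTime_eq_sample {T : ℝ} (hT : 0 ≤ T) {η : ℝ} {ω : PricePath T} {n : ℕ}
    {t : Icc (0 : ℝ) T} (h : oscTime hT η n ω ≤ t) :
    ω (capTime (oscTime hT η n ω) t) = sample hT η ω n := by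
  unfold sample
  obtain ⟨s, hs⟩ := WithTop.ne_top_iff_exists.1 (ne_top_of_le_ne_top WithTop.coe_ne_top h)
  rw [← hs] at h ⊢
  rw [capTime_coe (WithTop.coe_le_coe.1 h), capTime_coe s.2.2]

theorem abs_eval_sub_sample_lt {T : ℝ} (hT : 0 ≤ T) {η : ℝ} (hη : 0 < η) (ω : PricePath T) {n : ℕ}
    {t : Icc (0 : ℝ) T} (h : oscTime hT η n ω ≤ t) (h' : t < oscTime hT η (n + 1) ω) :
    |ω t - sample hT η ω n| < η := by
  rw [← eval_capTime_eq_sample hT h]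
  obtain ⟨s, hs⟩ := WithTop.ne_top_iff_exists.1 (ne_top_of_le_ne_top WithTop.coe_ne_top h)
  have hst : s ≤ t := WithTop.coe_le_coe.1 (hs ▸ h)
  refine abs_sub_lt_of_lt_oscTime hT hη ω h' h le_rfl ?_ ?_ <;> rw [← hs, capTime_coe hst]
  exact hst

/-! ### Measurability of positions and capital processes -/

/-- For a function vanishing where the stopping time is infinite, measurability with respect to the
σ-algebra of the stopping time can be tested on the events `{σ ≤ t}`. -/
theorem measurable_of_indicator {T : ℝ} (hT : 0 ≤ T) {σ : PricePath T → WithTop (Icc (0 : ℝ) T)}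
    (hσ : IsStoppingTime (pathFiltration T) σ) {f : PricePath T → ℝ}
    (hf : ∀ t, Measurable[pathFiltration T t] ({ω | σ ω ≤ t}.indicator f))
    (htop : ∀ ω, σ ω = ⊤ → f ω = 0) : Measurable[hσ.measurableSpace] f := by
  intro B hB
  rw [hσ.measurableSet]
  constructor
  · refine le_iSup (fun t => (pathFiltration T t : MeasurableSpace _))
      (⟨T, right_mem_Icc.2 hT⟩ : Icc (0 : ℝ) T) _ ?_
    have : {ω | σ ω ≤ ((⟨T, right_mem_Icc.2 hT⟩ : Icc (0 : ℝ) T) :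
        WithTop (Icc (0 : ℝ) T))}.indicator f = f := by
      refine indicator_eq_self.2 fun ω hω => ?_
      obtain ⟨s, hs⟩ := WithTop.ne_top_iff_exists.1 fun h => hω (htop ω h)
      rw [mem_ofPred_eq, ← hs, WithTop.coe_le_coe]
      exact s.2.2
    rw [← this]
    exact hf _ hB
  · intro t
    have : f ⁻¹' B ∩ {ω | σ ω ≤ t} = ({ω | σ ω ≤ t}.indicator f) ⁻¹' B ∩ {ω | σ ω ≤ t} := by
      ext ω
      simp only [mem_inter_iff, mem_preimage, mem_ofPred_eq]
      refine and_congr_left fun h => ?_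
      rw [indicator_of_mem (by exact h)]
    rw [this]
    exact (hf t hB).inter (hσ t)

theorem SimpleStrategy.measurable_capital {T : ℝ} (G : SimpleStrategy T) (t : Icc (0 : ℝ) T) :
    Measurable[pathFiltration T t] (G.capital t) := by
  have hterm : ∀ n, Measurable[pathFiltration T t] fun ω =>
      G.h n ω * (ω (capTime (G.τ (n + 1) ω) t) - ω (capTime (G.τ n ω) t)) := by
    intro n
    have hind : Measurable[pathFiltration T t] ({ω | G.τ n ω ≤ t}.indicator (G.h n)) := by
      intro B hB
      rw [indicator_preimage, Set.ite]
      exact (((G.isStoppingTime n).measurableSet _).1 (G.measurable_h n hB)).2 t |>.union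
        ((measurable_const hB).diff (G.isStoppingTime n t))
    -- If `τ n` is after `t`, both capped times are `t` and the increment of the path vanishes.
    have heq : (fun ω => G.h n ω * (ω (capTime (G.τ (n + 1) ω) t) - ω (capTime (G.τ n ω) t))) =
        fun ω => {ω | G.τ n ω ≤ t}.indicator (G.h n) ω *
          (ω (capTime (G.τ (n + 1) ω) t) - ω (capTime (G.τ n ω) t)) := by
      funext ω
      by_cases h : G.τ n ω ≤ t
      · rw [indicator_of_mem (by exact h)]
      · have h1 := (not_le.1 h).le
        rw [capTime_of_ge h1, capTime_of_ge (h1.trans (G.mono n ω))]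
        simp
    rw [heq]
    exact hind.mul ((measurable_eval_capTime (G.isStoppingTime _) t).sub
      (measurable_eval_capTime (G.isStoppingTime _) t))
  refine Measurable.const_add ?_ _
  refine @measurable_of_tendsto_metrizable _ _ (pathFiltration T t) _ _ _ _
    (fun N ω => ∑ n ∈ Finset.range N,
      G.h n ω * (ω (capTime (G.τ (n + 1) ω) t) - ω (capTime (G.τ n ω) t))) _
    (fun N => Finset.measurable_sum _ fun n _ => hterm n) ?_
  rw [tendsto_pi_nhds]
  intro ω
  rw [← tsum_eq_finsum (L := SummationFilter.unconditional ℕ) (G.finite_support t ω)]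
  exact (summable_of_hasFiniteSupport (G.finite_support t ω)).hasSum.tendsto_sum_nat

/-! ### Trading one band of prices along a sequence of prices -/

/-- The position after seeing the prices `x 0, …, x n`: one unit is bought at a price of at most
`α`, sold at a price of at least `β`, and otherwise the position is kept. -/
noncomputable def bandPosition (α β : ℝ) (x : ℕ → ℝ) : ℕ → ℝ
  | 0 => if x 0 ≤ α then 1 else 0
  | n + 1 => if x (n + 1) ≤ α then 1 else if β ≤ x (n + 1) then 0 else bandPosition α β x n

/-- The gain of the positions `p` over the prices `x 0, …, x n, z`. -/
def tradingGain (p x : ℕ → ℝ) (n : ℕ) (z : ℝ) : ℝ :=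
  ∑ i ∈ Finset.range n, p i * (x (i + 1) - x i) + p n * (z - x n)

theorem bandPosition_eq_zero_or_one (α β : ℝ) (x : ℕ → ℝ) (n : ℕ) :
    bandPosition α β x n = 0 ∨ bandPosition α β x n = 1 := by
  induction n with
  | zero => unfold bandPosition; split_ifs <;> simp
  | succ n ih => unfold bandPosition; split_ifs <;> simp [ih]

theorem bandPosition_of_le {α β : ℝ} {x : ℕ → ℝ} {n : ℕ} (h : x n ≤ α) :
    bandPosition α β x n = 1 := by
  cases n <;> simp [bandPosition, h]

theorem bandPosition_of_ge {α β : ℝ} (hαβ : α < β) {x : ℕ → ℝ} {n : ℕ} (h : β ≤ x n) :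
    bandPosition α β x n = 0 := by
  have : ¬ x n ≤ α := by linarith
  cases n <;> simp [bandPosition, h, this]

/-- The capital, for the initial capital `c`, in excess of the value `x n` of the unit held, or of
`α` if nothing is held. -/
noncomputable def bandExcess (α β c : ℝ) (x : ℕ → ℝ) (n : ℕ) : ℝ :=
  c + ∑ i ∈ Finset.range n, bandPosition α β x i * (x (i + 1) - x i)
    - bandPosition α β x n * x n - (1 - bandPosition α β x n) * α

/-- The excess never decreases, and a sale raises it by the width of the band. -/
theorem bandExcess_succ {α β : ℝ} (hαβ : α < β) (c : ℝ) (x : ℕ → ℝ) (n : ℕ) :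
    bandExcess α β c x n ≤ bandExcess α β c x (n + 1) ∧
    bandExcess α β c x n + (β - α) * (bandPosition α β x n - bandPosition α β x (n + 1))
      ≤ bandExcess α β c x (n + 1) := by
  unfold bandExcess
  rw [Finset.sum_range_succ]
  set V := ∑ i ∈ Finset.range n, bandPosition α β x i * (x (i + 1) - x i)
  have hp := bandPosition_eq_zero_or_one α β x n
  by_cases h1 : x (n + 1) ≤ α
  · rw [bandPosition_of_le h1]
    rcases hp with hp | hp <;> rw [hp] <;> constructor <;> linarith
  · by_cases h2 : β ≤ x (n + 1)
    · rw [bandPosition_of_ge hαβ h2]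
      rcases hp with hp | hp <;> rw [hp] <;> constructor <;> linarith
    · have h3 : bandPosition α β x (n + 1) = bandPosition α β x n := by
        rw [bandPosition, if_neg h1, if_neg h2]
      rw [h3]
      rcases hp with hp | hp <;> rw [hp] <;> constructor <;> linarith

theorem bandExcess_nonneg {α β c : ℝ} (hαβ : α < β) (hc : α ≤ c) (x : ℕ → ℝ) (n : ℕ) :
    0 ≤ bandExcess α β c x n := by
  refine le_trans ?_ (monotone_nat_of_le_succ (fun n => (bandExcess_succ hαβ c x n).1) n.zero_le)
  simp only [bandExcess, bandPosition, Finset.range_zero, Finset.sum_empty, add_zero]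
  split_ifs <;> linarith

/-- The excess is at most the capital, because the price of the unit held and `α` are
nonnegative. -/
theorem bandExcess_le_capital {α β c : ℝ} (hα : 0 ≤ α) (x : ℕ → ℝ) (n : ℕ) {z : ℝ} (hz : 0 ≤ z) :
    bandExcess α β c x n ≤ c + tradingGain (bandPosition α β x) x n z := by
  unfold bandExcess tradingGain
  rcases bandPosition_eq_zero_or_one α β x n with hp | hp <;> rw [hp] <;> linarith

/-- Twice the excess, plus the width of the band if a unit is held. Buying and selling each raise
it by at least the width of the band, and nothing lowers it. -/
noncomputable def bandPotential (α β c : ℝ) (x : ℕ → ℝ) (n : ℕ) : ℝ :=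
  2 * bandExcess α β c x n + (β - α) * bandPosition α β x n

theorem bandPotential_succ {α β : ℝ} (hαβ : α < β) (c : ℝ) (x : ℕ → ℝ) (n : ℕ) :
    bandPotential α β c x n + (β - α) * |bandPosition α β x (n + 1) - bandPosition α β x n|
      ≤ bandPotential α β c x (n + 1) := by
  obtain ⟨h1, h2⟩ := bandExcess_succ hαβ c x n
  unfold bandPotential
  rcases abs_cases (bandPosition α β x (n + 1) - bandPosition α β x n) with ⟨h, -⟩ | ⟨h, -⟩ <;>
    rw [h] <;> linarith

theorem bandPotential_add_le {α β : ℝ} (hαβ : α < β) (c : ℝ) (x : ℕ → ℝ) {m n : ℕ} (hmn : m ≤ n) :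
    bandPotential α β c x m + (β - α) * |bandPosition α β x n - bandPosition α β x m|
      ≤ bandPotential α β c x n := by
  induction n, hmn using Nat.le_induction with
  | base => simp
  | succ n hmn ih =>
    have h1 := bandPotential_succ hαβ c x n
    have h2 := mul_le_mul_of_nonneg_left
      (abs_sub_le (bandPosition α β x (n + 1)) (bandPosition α β x n) (bandPosition α β x m))
      (sub_pos.2 hαβ).le
    linarith

theorem bandPotential_nonneg {α β c : ℝ} (hαβ : α < β) (hc : α ≤ c) (x : ℕ → ℝ) (n : ℕ) :
    0 ≤ bandPotential α β c x n := by
  have h1 := bandExcess_nonneg hαβ hc x n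
  have h2 : 0 ≤ (β - α) * bandPosition α β x n := mul_nonneg (sub_pos.2 hαβ).le <| by
    rcases bandPosition_eq_zero_or_one α β x n with h | h <;> rw [h]
    exact zero_le_one
  unfold bandPotential
  linarith

/-- The number of changes of position seen along a monotone sequence of indices is bounded by the
final capital. -/
theorem sum_abs_bandPosition_sub_le {α β c : ℝ} (hα : 0 ≤ α) (hαβ : α < β) (hc : α ≤ c)
    (x : ℕ → ℝ) {N : ℕ → ℕ} (hN : Monotone N) (n : ℕ) {z : ℝ} (hz : 0 ≤ z) :
    (β - α) * ∑ i ∈ Finset.range n,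
        |bandPosition α β x (N (i + 1)) - bandPosition α β x (N i)|
      ≤ 2 * (c + tradingGain (bandPosition α β x) x (N n) z) + (β - α) := by
  have h : ∀ n, (β - α) * ∑ i ∈ Finset.range n,
      |bandPosition α β x (N (i + 1)) - bandPosition α β x (N i)| ≤
        bandPotential α β c x (N n) := by
    intro n
    induction n with
    | zero => simpa using bandPotential_nonneg hαβ hc x (N 0)
    | succ n ih =>
      rw [Finset.sum_range_succ, mul_add]
      exact (add_le_add_left ih _).trans (bandPotential_add_le hαβ c x (hN n.le_succ))
  have h1 := bandExcess_le_capital (β := β) (c := c) hα x (N n) hz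
  have h2 : (β - α) * bandPosition α β x (N n) ≤ β - α :=
    mul_le_of_le_one_right (sub_pos.2 hαβ).le <| by
      rcases bandPosition_eq_zero_or_one α β x (N n) with h | h <;> rw [h]
      exact zero_le_one
  have h3 := h n
  unfold bandPotential at h3
  linarith

/-! ### Crossings of a grid by an increment -/

/-- The increment from `x` to `y`, upwards or downwards, crosses the band from `a` to `b`. -/
def Crosses (a b x y : ℝ) : Prop := (x ≤ a ∧ b ≤ y) ∨ (y ≤ a ∧ b ≤ x)

open Classical in
/-- The number of bands `[kℓ, (k+1)ℓ]`, `k < N`, that are crossed by the increment from `x`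
to `y`. -/
noncomputable def crossCount (ℓ : ℝ) (N : ℕ) (x y : ℝ) : ℝ :=
  ∑ k ∈ Finset.range N, if Crosses (k * ℓ) ((k + 1) * ℓ) x y then 1 else 0

theorem crossCount_nonneg (ℓ : ℝ) (N : ℕ) (x y : ℝ) : 0 ≤ crossCount ℓ N x y :=
  Finset.sum_nonneg fun _ _ => by split_ifs <;> norm_num

theorem crossCount_comm (ℓ : ℝ) (N : ℕ) (x y : ℝ) : crossCount ℓ N x y = crossCount ℓ N y x := by
  classical exact Finset.sum_congr rfl fun _ _ => if_congr or_comm rfl rfl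

open Classical in
/-- An increment of at least two, or three, mesh sizes crosses at least one, or two, bands. -/
theorem crossCount_ge_of_le {ℓ : ℝ} (hℓ : 0 < ℓ) {N : ℕ} {x y : ℝ} (hx : 0 ≤ x) (hy : y ≤ N * ℓ) :
    (2 * ℓ ≤ y - x → 1 ≤ crossCount ℓ N x y) ∧ (3 * ℓ ≤ y - x → 2 ≤ crossCount ℓ N x y) := by
  set k := ⌈x / ℓ⌉₊
  have hk1 : x ≤ k * ℓ := (div_le_iff₀ hℓ).1 (Nat.le_ceil _)
  have hk2 : k * ℓ < x + ℓ := by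
    have := Nat.ceil_lt_add_one (div_nonneg hx hℓ.le)
    rw [div_add_one hℓ.ne', lt_div_iff₀ hℓ] at this
    exact this
  have hlt : ∀ m : ℕ, (m : ℝ) * ℓ < N * ℓ → m ∈ Finset.range N := fun m hm =>
    Finset.mem_range.2 (by exact_mod_cast lt_of_mul_lt_mul_right hm hℓ.le)
  have hle : ∀ s ⊆ Finset.range N, (∀ m ∈ s, Crosses (m * ℓ) ((m + 1) * ℓ) x y) →
      (s.card : ℝ) ≤ crossCount ℓ N x y := by
    intro s hs hc
    calc (s.card : ℝ) = ∑ m ∈ s, (if Crosses (m * ℓ) ((m + 1) * ℓ) x y then 1 else 0 : ℝ) := by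
          rw [Finset.sum_congr rfl fun m hm => if_pos (hc m hm)]; simp
      _ ≤ _ := Finset.sum_le_sum_of_subset_of_nonneg hs fun _ _ _ => by split_ifs <;> norm_num
  constructor
  · intro h
    refine le_of_eq_of_le ?_ (hle {k} ?_ ?_)
    · simp
    · simpa using hlt k (by linarith)
    · intro m hm
      rw [Finset.mem_singleton.1 hm]
      exact Or.inl ⟨hk1, by linarith⟩
  · intro h
    refine le_of_eq_of_le ?_ (hle {k, k + 1} ?_ ?_)
    · rw [Finset.card_pair (by omega)]; norm_num
    · intro m hm
      rcases Finset.mem_insert.1 hm with rfl | hm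
      · exact hlt _ (by linarith)
      · rw [Finset.mem_singleton.1 hm]
        exact hlt _ (by push_cast; linarith)
    · intro m hm
      rcases Finset.mem_insert.1 hm with rfl | hm
      · exact Or.inl ⟨hk1, by linarith⟩
      · rw [Finset.mem_singleton.1 hm]
        exact Or.inl ⟨by push_cast; linarith, by push_cast; linarith⟩

/-- The factor `16/9` makes up for the bands being traded only between slightly narrower
levels. It is available because an increment close to `4ℓ` crosses two bands. -/
theorem rpow_abs_sub_le_crossCount {ℓ p : ℝ} (hℓ : 0 < ℓ) (hp : 2 ≤ p) {N : ℕ} {x y : ℝ}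
    (hx : 0 ≤ x) (hy : 0 ≤ y) (hxN : x ≤ N * ℓ) (hyN : y ≤ N * ℓ) (h2 : 2 * ℓ ≤ |y - x|)
    (h4 : |y - x| ≤ 4 * ℓ) :
    16 / 9 * |y - x| ^ p ≤ (4 * ℓ) ^ p * crossCount ℓ N x y := by
  wlog hxy : x ≤ y generalizing x y
  · rw [abs_sub_comm, crossCount_comm]
    rw [abs_sub_comm] at h2 h4
    exact this hy hx hyN hxN h2 h4 (le_of_not_ge hxy)
  rw [abs_of_nonneg (sub_nonneg.2 hxy)] at *
  obtain ⟨hc1, hc2⟩ := crossCount_ge_of_le hℓ hx hyN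
  have hpos : 0 < (4 * ℓ) ^ p := by positivity
  have hd : 0 ≤ y - x := sub_nonneg.2 hxy
  rcases le_total (3 * ℓ) (y - x) with h | h
  · have e1 : (y - x) ^ p ≤ (4 * ℓ) ^ p := Real.rpow_le_rpow hd h4 (by linarith)
    have e2 := mul_le_mul_of_nonneg_left (hc2 h) hpos.le
    linarith
  · have e1 : (y - x) ^ p ≤ (3 / 4 * (4 * ℓ)) ^ p :=
      Real.rpow_le_rpow hd (by linarith) (by linarith)
    rw [Real.mul_rpow (by norm_num) (by linarith)] at e1
    have e2 : ((3 : ℝ) / 4) ^ p ≤ 9 / 16 := by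
      refine (Real.rpow_le_rpow_of_exponent_ge (by norm_num) (by norm_num) hp).trans_eq ?_
      norm_num
    have e3 := mul_le_mul_of_nonneg_left (hc1 h2) hpos.le
    have e4 := mul_le_mul_of_nonneg_right e2 hpos.le
    linarith

/-- A position in a narrower band changes between two indices at which the prices are within `η`
of the two ends of an increment crossing the band. -/
theorem one_le_abs_bandPosition_sub {a b η : ℝ} (hab : a + η < b - η) {x : ℕ → ℝ} {m n : ℕ}
    {y z : ℝ} (hy : |y - x m| < η) (hz : |z - x n| < η) (h : Crosses a b y z) :
    1 ≤ |bandPosition (a + η) (b - η) x n - bandPosition (a + η) (b - η) x m| := by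
  rw [abs_lt] at hy hz
  rcases h with ⟨h1, h2⟩ | ⟨h1, h2⟩
  · rw [bandPosition_of_le (n := m) (by linarith), bandPosition_of_ge hab (n := n) (by linarith)]
    norm_num
  · rw [bandPosition_of_le (n := n) (by linarith), bandPosition_of_ge hab (n := m) (by linarith)]
    norm_num

/-! ### Trading all bands of a grid -/

theorem measurable_bandPosition_sample {T : ℝ} (hT : 0 ≤ T) {η : ℝ} (hη : 0 < η) (α β : ℝ) (n : ℕ)
    (t : Icc (0 : ℝ) T) :
    Measurable[pathFiltration T t] ({ω | oscTime hT η n ω ≤ t}.indicator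
      fun ω => bandPosition α β (sample hT η ω) n) := by
  let _ : MeasurableSpace (PricePath T) := pathFiltration T t
  have hx : ∀ n, Measurable fun ω : PricePath T => ω (capTime (oscTime hT η n ω) t) :=
    fun n => measurable_eval_capTime (isStoppingTime_oscTime hT hη n) t
  have hS : ∀ n, MeasurableSet {ω : PricePath T | oscTime hT η n ω ≤ t} :=
    fun n => isStoppingTime_oscTime hT hη n t
  induction n with
  | zero =>
    have : ({ω | oscTime hT η 0 ω ≤ t}.indicator
        fun ω => bandPosition α β (sample hT η ω) 0) = {ω | oscTime hT η 0 ω ≤ t}.indicator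
        fun ω => if ω (capTime (oscTime hT η 0 ω) t) ≤ α then 1 else 0 :=
      indicator_congr fun ω hω => by rw [bandPosition, eval_capTime_eq_sample hT hω]
    rw [this]
    exact (Measurable.ite (measurableSet_le (hx 0) measurable_const) measurable_const
      measurable_const).indicator (hS 0)
  | succ n ih =>
    have : ({ω | oscTime hT η (n + 1) ω ≤ t}.indicator
        fun ω => bandPosition α β (sample hT η ω) (n + 1)) =
        {ω | oscTime hT η (n + 1) ω ≤ t}.indicator fun ω =>
          if ω (capTime (oscTime hT η (n + 1) ω) t) ≤ α then 1 else
          if β ≤ ω (capTime (oscTime hT η (n + 1) ω) t) then 0 else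
          {ω | oscTime hT η n ω ≤ t}.indicator
            (fun ω => bandPosition α β (sample hT η ω) n) ω := by
      refine indicator_congr fun ω hω => ?_
      have hω' : ω ∈ {ω | oscTime hT η n ω ≤ t} := (oscTime_le_succ hT hη n ω).trans hω
      rw [bandPosition, eval_capTime_eq_sample hT hω, indicator_of_mem hω']
    rw [this]
    exact (Measurable.ite (measurableSet_le (hx _) measurable_const) measurable_const
      (Measurable.ite (measurableSet_le measurable_const (hx _)) measurable_const ih)).indicator
        (hS _)

/-- The lower trading level of the `k`-th band of mesh `ℓ`. The levels are drawn in from the ends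
of the band by `ℓ / 5`, the oscillation of the path between sampling times. -/
noncomputable def lowerLevel (ℓ : ℝ) (k : ℕ) : ℝ := k * ℓ + ℓ / 5

/-- The upper trading level of the `k`-th band of mesh `ℓ`. -/
noncomputable def upperLevel (ℓ : ℝ) (k : ℕ) : ℝ := (k + 1) * ℓ - ℓ / 5

/-- The joint position, with weight `s`, in the bands `[kℓ, (k+1)ℓ]`, `k < N`. -/
noncomputable def gridPosition (s ℓ : ℝ) (N : ℕ) (x : ℕ → ℝ) (n : ℕ) : ℝ :=
  s * ∑ k ∈ Finset.range N, bandPosition (lowerLevel ℓ k) (upperLevel ℓ k) x n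

theorem tradingGain_gridPosition (s ℓ : ℝ) (N : ℕ) (x : ℕ → ℝ) (n : ℕ) (z : ℝ) :
    tradingGain (gridPosition s ℓ N x) x n z = s * ∑ k ∈ Finset.range N,
      tradingGain (bandPosition (lowerLevel ℓ k) (upperLevel ℓ k) x) x n z := by
  simp only [tradingGain, gridPosition, Finset.sum_add_distrib, mul_add, Finset.mul_sum,
    Finset.sum_mul, mul_assoc]
  rw [Finset.sum_comm]

open Classical in
/-- The strategy that trades, with weight `s`, in all bands `[kℓ, (k+1)ℓ]`, `k < N`, at the times at
which the oscillation of the path reaches `ℓ / 5`. The `k`-th band has initial capital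
`(k + 1/2)ℓ`, more than its lower trading level. -/
noncomputable def gridStrategy {T : ℝ} (hT : 0 ≤ T) (s : ℝ) {ℓ : ℝ} (hℓ : 0 < ℓ) (N : ℕ) :
    SimpleStrategy T where
  initial := s * ∑ k ∈ Finset.range N, ((k : ℝ) + 1 / 2) * ℓ
  τ := oscTime hT (ℓ / 5)
  isStoppingTime := isStoppingTime_oscTime hT (by positivity)
  mono := oscTime_le_succ hT (by positivity)
  finite := finite_oscTime_ne_top hT (by positivity)
  h n ω := if oscTime hT (ℓ / 5) n ω = ⊤ then 0 else gridPosition s ℓ N (sample hT (ℓ / 5) ω) n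
  measurable_h n := by
    refine measurable_of_indicator hT _ (fun t => ?_) fun ω h => if_pos h
    have : ({ω | oscTime hT (ℓ / 5) n ω ≤ t}.indicator fun ω =>
        if oscTime hT (ℓ / 5) n ω = ⊤ then 0 else gridPosition s ℓ N (sample hT (ℓ / 5) ω) n) =
        fun ω => s * ∑ k ∈ Finset.range N, {ω | oscTime hT (ℓ / 5) n ω ≤ t}.indicator
          (fun ω => bandPosition (lowerLevel ℓ k) (upperLevel ℓ k) (sample hT (ℓ / 5) ω) n) ω := by
      funext ω
      by_cases h : ω ∈ {ω | oscTime hT (ℓ / 5) n ω ≤ t}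
      · simp only [indicator_of_mem h]
        exact if_neg (ne_top_of_le_ne_top WithTop.coe_ne_top h)
      · simp only [indicator_of_notMem h, Finset.sum_const_zero, mul_zero]
    rw [this]
    exact Measurable.const_mul (Finset.measurable_sum _ fun k _ =>
      measurable_bandPosition_sample hT (by positivity) _ _ n t) s
  bounded_h n := by
    refine ⟨|s| * N, fun ω => ?_⟩
    split_ifs
    · simpa using mul_nonneg (abs_nonneg s) N.cast_nonneg
    · rw [gridPosition, abs_mul]
      refine mul_le_mul_of_nonneg_left ((Finset.abs_sum_le_sum_abs _ _).trans ?_) (abs_nonneg s)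
      refine (Finset.sum_le_card_nsmul _ _ 1 fun k _ => ?_).trans_eq (by simp)
      rcases bandPosition_eq_zero_or_one (lowerLevel ℓ k) (upperLevel ℓ k)
        (sample hT (ℓ / 5) ω) n with h | h <;> simp [h]

theorem gridStrategy_capital {T : ℝ} (hT : 0 ≤ T) (s : ℝ) {ℓ : ℝ} (hℓ : 0 < ℓ) (N : ℕ)
    {t : Icc (0 : ℝ) T} {ω : PricePath T} {n : ℕ} (hn : oscTime hT (ℓ / 5) n ω ≤ t)
    (hn' : t < oscTime hT (ℓ / 5) (n + 1) ω) :
    (gridStrategy hT s hℓ N).capital t ω = s * ∑ k ∈ Finset.range N, (((k : ℝ) + 1 / 2) * ℓ +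
      tradingGain (bandPosition (lowerLevel ℓ k) (upperLevel ℓ k) (sample hT (ℓ / 5) ω))
        (sample hT (ℓ / 5) ω) n (ω t)) := by
  have hη : 0 < ℓ / 5 := by positivity
  have hmono := monotone_oscTime hT hη ω
  have hle : ∀ i ≤ n, oscTime hT (ℓ / 5) i ω ≤ t := fun i hi => (hmono hi).trans hn
  have hge : ∀ i, n < i → t ≤ oscTime hT (ℓ / 5) i ω := fun i hi =>
    hn'.le.trans (hmono (Nat.succ_le_of_lt hi))
  have hpos : ∀ i ≤ n, (gridStrategy hT s hℓ N).h i ω =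
      gridPosition s ℓ N (sample hT (ℓ / 5) ω) i := fun i hi =>
    if_neg (ne_top_of_le_ne_top WithTop.coe_ne_top (hle i hi))
  rw [Finset.sum_add_distrib, mul_add, ← tradingGain_gridPosition, tradingGain,
    SimpleStrategy.capital, finsum_eq_sum_of_support_subset (s := Finset.range (n + 1)),
    Finset.sum_range_succ]
  · congr 2
    · refine Finset.sum_congr rfl fun i hi => ?_
      have hi := Finset.mem_range.1 hi
      rw [hpos i hi.le, ← eval_capTime_eq_sample hT (hle i hi.le),
        ← eval_capTime_eq_sample hT (hle (i + 1) hi)]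
      rfl
    · rw [hpos n le_rfl, ← eval_capTime_eq_sample hT hn]
      congr 3
      exact capTime_of_ge (hge (n + 1) n.lt_succ_self)
  · intro i hi
    by_contra h
    have hi' : n < i := by simpa using h
    refine hi (mul_eq_zero_of_right _ (sub_eq_zero.2 (congrArg ω ?_)))
    exact (capTime_of_ge (hge (i + 1) (by omega))).trans (capTime_of_ge (hge i hi')).symm

theorem gridStrategy_capital_nonneg {T : ℝ} (hT : 0 ≤ T) {s : ℝ} (hs : 0 ≤ s) {ℓ : ℝ} (hℓ : 0 < ℓ)
    (N : ℕ) (t : Icc (0 : ℝ) T) (ω : PricePath T) :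
    0 ≤ (gridStrategy hT s hℓ N).capital t ω := by
  obtain ⟨n, hn, hn'⟩ := exists_oscTime_le_lt hT (by positivity : 0 < ℓ / 5) ω t
  rw [gridStrategy_capital hT s hℓ N hn hn']
  refine mul_nonneg hs (Finset.sum_nonneg fun k _ =>
    (bandExcess_nonneg ?_ ?_ _ n).trans (bandExcess_le_capital ?_ _ n (ω.nonneg' t)))
  · unfold lowerLevel upperLevel; linarith
  · unfold lowerLevel; linarith
  · unfold lowerLevel; positivity

/-- The capital of the grid strategy bounds the number of band crossings of the increments of the
path along a partition. -/
theorem crossCount_le_gridStrategy_capital {T : ℝ} (hT : 0 ≤ T) {s : ℝ} (hs : 0 ≤ s) {ℓ : ℝ}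
    (hℓ : 0 < ℓ) (N : ℕ) (ω : PricePath T) {t : ℕ → Icc (0 : ℝ) T} (ht : Monotone t) (n : ℕ) :
    3 / 10 * ℓ * s * ∑ i ∈ Finset.range n, crossCount ℓ N (ω (t i)) (ω (t (i + 1)))
      ≤ (gridStrategy hT s hℓ N).capital (t n) ω + 3 / 10 * ℓ * s * N := by
  have hη : 0 < ℓ / 5 := by positivity
  choose I hI hI' using fun i => exists_oscTime_le_lt hT hη ω (t i)
  have hImono : Monotone I := fun i j hij => by
    by_contra h
    have h1 := monotone_oscTime hT hη ω (show I j + 1 ≤ I i by omega)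
    exact absurd ((hI' j).trans_le (h1.trans (hI i))) (by
      rw [WithTop.coe_lt_coe, not_lt]; exact ht hij)
  rw [gridStrategy_capital hT s hℓ N (hI n) (hI' n)]
  set x := sample hT (ℓ / 5) ω
  have hband : ∀ k ∈ Finset.range N, (3 / 5 * ℓ) * ∑ i ∈ Finset.range n,
      (open Classical in
        if Crosses (k * ℓ) ((k + 1) * ℓ) (ω (t i)) (ω (t (i + 1))) then (1 : ℝ) else 0) ≤
      2 * (((k : ℝ) + 1 / 2) * ℓ +
        tradingGain (bandPosition (lowerLevel ℓ k) (upperLevel ℓ k) x) x (I n) (ω (t n)))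
      + 3 / 5 * ℓ := by
    intro k _
    have hw : upperLevel ℓ k - lowerLevel ℓ k = 3 / 5 * ℓ := by
      unfold upperLevel lowerLevel; ring
    have h := sum_abs_bandPosition_sub_le (α := lowerLevel ℓ k) (β := upperLevel ℓ k)
      (c := ((k : ℝ) + 1 / 2) * ℓ) (by unfold lowerLevel; positivity)
      (sub_pos.1 (by rw [hw]; positivity)) (by unfold lowerLevel; linarith) x hImono n
      (ω.nonneg' (t n))
    rw [hw] at h
    refine le_trans ?_ h
    refine mul_le_mul_of_nonneg_left (Finset.sum_le_sum fun i _ => ?_) (by positivity)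
    split_ifs with hc
    · exact one_le_abs_bandPosition_sub (by linarith)
        (abs_eval_sub_sample_lt hT hη ω (hI i) (hI' i))
        (abs_eval_sub_sample_lt hT hη ω (hI (i + 1)) (hI' (i + 1))) hc
    · exact abs_nonneg _
  have hsum := mul_le_mul_of_nonneg_left (Finset.sum_le_sum hband) hs
  simp only [crossCount]
  rw [Finset.sum_comm]
  rw [← Finset.mul_sum, Finset.sum_add_distrib, ← Finset.mul_sum, Finset.sum_const,
    Finset.card_range, nsmul_eq_mul] at hsum
  linarith

theorem SimpleStrategy.capital_zero {T : ℝ} (hT : 0 ≤ T) (G : SimpleStrategy T) (ω : PricePath T) :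
    G.capital ⟨0, left_mem_Icc.2 hT⟩ ω = G.initial := by
  have h : ∀ σ : WithTop (Icc (0 : ℝ) T), capTime σ ⟨0, left_mem_Icc.2 hT⟩ =
      ⟨0, left_mem_Icc.2 hT⟩ := fun σ => min_eq_right (Subtype.coe_le_coe.1 (σ.untopD _).2.1)
  simp [SimpleStrategy.capital, h]

/-! ### The capital process -/

/-- The initial capital spent on the grid of the `j`-th level for paths bounded by `2 ^ L`. -/
noncomputable def levelCapital (ε δ : ℝ) (L j : ℕ) : ℝ :=
  ((1 - (2 : ℝ) ^ (-δ)) * ((2 : ℝ) ^ (-δ)) ^ L) * ((1 - (2 : ℝ) ^ (-ε)) * ((2 : ℝ) ^ (-ε)) ^ j)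

/-- The mesh `2 ^ L / 2 ^ (j + 2)` of the grid of the `j`-th level for paths bounded by `2 ^ L`. -/
noncomputable def levelMesh (L j : ℕ) : ℝ := 2 ^ L / 2 ^ (j + 2)

/-- The weight of the bands of the `j`-th level; the initial capitals of these bands add up to
`2 ^ L * 2 ^ (j + 1)` before weighting. -/
noncomputable def levelWeight (ε δ : ℝ) (L j : ℕ) : ℝ :=
  levelCapital ε δ L j / (2 ^ L * 2 ^ (j + 1))

theorem levelMesh_pos (L j : ℕ) : 0 < levelMesh L j := by unfold levelMesh; positivity

theorem two_rpow_neg_lt_one {a : ℝ} (ha : 0 < a) : (2 : ℝ) ^ (-a) < 1 :=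
  Real.rpow_lt_one_of_one_lt_of_neg one_lt_two (neg_neg_of_pos ha)

theorem levelCapital_pos {ε δ : ℝ} (hε : 0 < ε) (hδ : 0 < δ) (L j : ℕ) :
    0 < levelCapital ε δ L j := by
  have h1 := sub_pos.2 (two_rpow_neg_lt_one hε)
  have h2 := sub_pos.2 (two_rpow_neg_lt_one hδ)
  unfold levelCapital
  positivity

theorem levelWeight_pos {ε δ : ℝ} (hε : 0 < ε) (hδ : 0 < δ) (L j : ℕ) :
    0 < levelWeight ε δ L j := div_pos (levelCapital_pos hε hδ L j) (by positivity)

/-- The grid strategy of the `j`-th level for paths bounded by `2 ^ L`. -/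
noncomputable def levelStrategy {T : ℝ} (hT : 0 ≤ T) (ε δ : ℝ) (L j : ℕ) : SimpleStrategy T :=
  gridStrategy hT (levelWeight ε δ L j) (levelMesh_pos L j) (2 ^ (j + 2))

theorem levelStrategy_initial {T : ℝ} (hT : 0 ≤ T) (ε δ : ℝ) (L j : ℕ) :
    (levelStrategy hT ε δ L j).initial = levelCapital ε δ L j := by
  have hsum : ∀ N : ℕ, ∑ k ∈ Finset.range N, ((k : ℝ) + 1 / 2) * levelMesh L j =
      levelMesh L j * N ^ 2 / 2 := by
    intro N
    induction N with
    | zero => simp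
    | succ N ih => rw [Finset.sum_range_succ, ih]; push_cast; ring
  change levelWeight ε δ L j * ∑ k ∈ Finset.range (2 ^ (j + 2)), _ = _
  rw [hsum, levelWeight, levelMesh]
  push_cast
  field_simp
  ring

theorem hasSum_levelCapital {ε δ : ℝ} (hε : 0 < ε) (hδ : 0 < δ) :
    HasSum (fun m : ℕ => levelCapital ε δ m.unpair.1 m.unpair.2) 1 := by
  have hgeom : ∀ a : ℝ, 0 < a →
      HasSum (fun n : ℕ => (1 - (2 : ℝ) ^ (-a)) * ((2 : ℝ) ^ (-a)) ^ n) 1 := by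
    intro a ha
    have h1 := two_rpow_neg_lt_one ha
    have h := (hasSum_geometric_of_lt_one (by positivity) h1).mul_left (1 - (2 : ℝ) ^ (-a))
    rwa [mul_inv_cancel₀ (sub_pos.2 h1).ne'] at h
  have hnn : ∀ a : ℝ, 0 < a → ∀ n : ℕ, 0 ≤ (1 - (2 : ℝ) ^ (-a)) * ((2 : ℝ) ^ (-a)) ^ n :=
    fun a ha n => mul_nonneg (sub_pos.2 (two_rpow_neg_lt_one ha)).le (by positivity)
  have h := (hgeom δ hδ).mul (hgeom ε hε) ((hgeom δ hδ).summable.mul_of_nonneg (hgeom ε hε).summable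
    (hnn δ hδ) (hnn ε hε))
  rw [one_mul] at h
  have h' : HasSum (fun p : ℕ × ℕ => levelCapital ε δ p.1 p.2) 1 := h
  exact (Equiv.hasSum_iff Nat.pairEquiv.symm (f := fun p : ℕ × ℕ => levelCapital ε δ p.1 p.2)).2 h'

/-- The sum of the capital processes of all levels. -/
noncomputable def variationCapital {T : ℝ} (hT : 0 ≤ T) (ε δ : ℝ) (t : Icc (0 : ℝ) T)
    (ω : PricePath T) : ℝ≥0∞ :=
  ∑' m : ℕ, ENNReal.ofReal ((levelStrategy hT ε δ m.unpair.1 m.unpair.2).capital t ω)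

theorem isPositiveCapitalProcess_variationCapital {T : ℝ} (hT : 0 ≤ T) {ε δ : ℝ} (hε : 0 < ε)
    (hδ : 0 < δ) : IsPositiveCapitalProcess fun t ω => (variationCapital hT ε δ t ω : EReal) := by
  refine ⟨fun t => ?_, fun m => levelStrategy hT ε δ m.unpair.1 m.unpair.2,
    fun m t ω => gridStrategy_capital_nonneg hT (levelWeight_pos hε hδ _ _).le _ _ t ω, ?_,
    fun t ω => rfl⟩
  · let _ : MeasurableSpace (PricePath T) := pathFiltration T t
    exact measurable_coe_ennreal_ereal.comp <| Measurable.tsum fun m =>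
      ENNReal.measurable_ofReal.comp (SimpleStrategy.measurable_capital _ t)
  · simp only [levelStrategy_initial]
    exact (hasSum_levelCapital hε hδ).summable

theorem variationCapital_zero {T : ℝ} (hT : 0 ≤ T) {ε δ : ℝ} (hε : 0 < ε) (hδ : 0 < δ)
    (ω : PricePath T) : variationCapital hT ε δ ⟨0, left_mem_Icc.2 hT⟩ ω = 1 := by
  have hzero : ∀ m : ℕ, (levelStrategy hT ε δ m.unpair.1 m.unpair.2).capital
      ⟨0, left_mem_Icc.2 hT⟩ ω = levelCapital ε δ m.unpair.1 m.unpair.2 := fun m => by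
    rw [SimpleStrategy.capital_zero hT, levelStrategy_initial]
  simp only [variationCapital, hzero]
  have h := hasSum_levelCapital hε hδ
  rw [← ENNReal.ofReal_tsum_of_nonneg (fun m => (levelCapital_pos hε hδ _ _).le) h.summable,
    h.tsum_eq, ENNReal.ofReal_one]

theorem tsum_levelStrategy_le {T : ℝ} (hT : 0 ≤ T) (ε δ : ℝ) (L : ℕ) (t : Icc (0 : ℝ) T)
    (ω : PricePath T) : ∑' j, ENNReal.ofReal ((levelStrategy hT ε δ L j).capital t ω) ≤
      variationCapital hT ε δ t ω := by
  have hinj : Function.Injective fun j => Nat.pair L j := fun i j h => (Nat.pair_eq_pair.1 h).2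
  refine le_of_eq_of_le (tsum_congr fun j => ?_) (ENNReal.tsum_comp_le_tsum_of_injective hinj _)
  simp only [Nat.unpair_pair]

/-! ### Bounding the variation -/

/-- The coefficient of the variation in the capital earned on paths bounded by `2 ^ L`. -/
noncomputable def variationCoeff (ε δ : ℝ) (L : ℕ) : ℝ :=
  (1 - (2 : ℝ) ^ (-δ)) * ((2 : ℝ) ^ (-δ)) ^ L * (1 - (2 : ℝ) ^ (-ε)) / (16 * (2 ^ L) ^ (2 + ε))

theorem variationCoeff_pos {ε δ : ℝ} (hε : 0 < ε) (hδ : 0 < δ) (L : ℕ) :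
    0 < variationCoeff ε δ L := by
  have h1 := sub_pos.2 (two_rpow_neg_lt_one hε)
  have h2 := sub_pos.2 (two_rpow_neg_lt_one hδ)
  unfold variationCoeff
  positivity

theorem variationCoeff_mul_rpow_le {ε δ : ℝ} (hε : 0 < ε) (hδ : 0 < δ) (L j : ℕ) :
    9 / 16 * (variationCoeff ε δ L * (4 * levelMesh L j) ^ (2 + ε)) ≤
      3 / 10 * levelMesh L j * levelWeight ε δ L j := by
  have hcap := levelCapital_pos hε hδ L j
  have hmesh : 4 * levelMesh L j = 2 ^ L / 2 ^ j := by
    unfold levelMesh; rw [pow_add]; field_simp; ring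
  have hpow : ((2 : ℝ) ^ j) ^ (2 + ε) = 4 ^ j * (((2 : ℝ) ^ (-ε)) ^ j)⁻¹ := by
    rw [Real.rpow_add (by positivity), ← Real.rpow_natCast 2 j, ← Real.rpow_mul zero_le_two,
      ← Real.rpow_mul zero_le_two, ← Real.rpow_natCast ((2 : ℝ) ^ (-ε)),
      ← Real.rpow_mul zero_le_two, ← Real.rpow_neg zero_le_two,
      show (4 : ℝ) = 2 ^ (2 : ℝ) by norm_num, ← Real.rpow_natCast _ j, ← Real.rpow_mul zero_le_two]
    congr 2 <;> ring
  have e1 : variationCoeff ε δ L * (4 * levelMesh L j) ^ (2 + ε) =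
      levelCapital ε δ L j / (16 * 4 ^ j) := by
    rw [hmesh, Real.div_rpow (by positivity) (by positivity), hpow, variationCoeff, levelCapital]
    field_simp
  have e2 : levelMesh L j * levelWeight ε δ L j = levelCapital ε δ L j / (8 * 4 ^ j) := by
    rw [levelMesh, levelWeight, show (4 : ℝ) ^ j = 2 ^ j * 2 ^ j by rw [← mul_pow]; norm_num]
    field_simp
    ring
  rw [mul_assoc (3 / 10), e1, e2]
  -- The claim is now `9 / 256 ≤ 3 / 80`; here the factor `16 / 9` is used.
  have e3 : levelCapital ε δ L j / (16 * 4 ^ j) = 1 / 2 * (levelCapital ε δ L j / (8 * 4 ^ j)) := by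
    field_simp; ring
  have e4 : 0 < levelCapital ε δ L j / (8 * 4 ^ j) := by positivity
  linarith

/-- Every increment is paid for by the bands of the level whose mesh is between a quarter and a half
of it. -/
theorem exists_variationCoeff_mul_le {ε δ : ℝ} (hε : 0 < ε) (hδ : 0 < δ) (L : ℕ) {x y : ℝ}
    (hx : 0 ≤ x) (hy : 0 ≤ y) (hxL : x ≤ 2 ^ L) (hyL : y ≤ 2 ^ L) :
    ∃ j, variationCoeff ε δ L * |y - x| ^ (2 + ε) ≤
      3 / 10 * levelMesh L j * levelWeight ε δ L j *
        crossCount (levelMesh L j) (2 ^ (j + 2)) x y := by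
  rcases eq_or_ne y x with rfl | hne
  · refine ⟨0, ?_⟩
    rw [sub_self, abs_zero, Real.zero_rpow (by linarith), mul_zero]
    have := levelMesh_pos L 0
    have := levelWeight_pos hε hδ L 0
    have := crossCount_nonneg (levelMesh L 0) (2 ^ (0 + 2)) y y
    positivity
  have hu : (0 : ℝ) < 2 ^ L := by positivity
  have hd : 0 < |y - x| := abs_pos.2 (sub_ne_zero.2 hne)
  have hdu : |y - x| ≤ 2 ^ L := abs_le.2 ⟨by linarith, by linarith⟩
  obtain ⟨j, hj1, hj2⟩ := exists_nat_pow_near_of_lt_one (div_pos hd hu) ((div_le_one hu).2 hdu)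
    (by norm_num : (0 : ℝ) < 1 / 2) (by norm_num)
  rw [lt_div_iff₀ hu] at hj1
  rw [div_le_iff₀ hu] at hj2
  have h2 : 2 * levelMesh L j = (1 / 2) ^ (j + 1) * 2 ^ L := by
    unfold levelMesh; rw [one_div, inv_pow]; field_simp; ring
  have h4 : 4 * levelMesh L j = (1 / 2) ^ j * 2 ^ L := by
    unfold levelMesh; rw [one_div, inv_pow]; field_simp; ring
  have hN : ((2 ^ (j + 2) : ℕ) : ℝ) * levelMesh L j = 2 ^ L := by
    unfold levelMesh; push_cast; field_simp
  refine ⟨j, ?_⟩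
  have h := rpow_abs_sub_le_crossCount (levelMesh_pos L j) (p := 2 + ε) (by linarith) hx hy
    (hxL.trans hN.ge) (hyL.trans hN.ge) (h2 ▸ hj1.le) (h4 ▸ hj2)
  have h5 := mul_le_mul_of_nonneg_left h (variationCoeff_pos hε hδ L).le
  have h6 := mul_le_mul_of_nonneg_right (variationCoeff_mul_rpow_le hε hδ L j)
    (crossCount_nonneg (levelMesh L j) (2 ^ (j + 2)) x y)
  linarith

/-- The crossings that the strategies do not see, at most one for each band, cost at most
`3 / 20` in all. -/
theorem tsum_levelCost_le {ε δ : ℝ} (hε : 0 < ε) (hδ : 0 < δ) (L : ℕ) :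
    ∑' j, ENNReal.ofReal (3 / 10 * levelMesh L j * levelWeight ε δ L j * (2 ^ (j + 2) : ℕ)) ≤
      ENNReal.ofReal (3 / 20) := by
  set q := (2 : ℝ) ^ (-ε)
  set r := (2 : ℝ) ^ (-δ)
  have hq : q < 1 := two_rpow_neg_lt_one hε
  have hr : r < 1 := two_rpow_neg_lt_one hδ
  have hq0 : 0 < q := by positivity
  have hr0 : 0 < r := by positivity
  have hterm : ∀ j, 3 / 10 * levelMesh L j * levelWeight ε δ L j * (2 ^ (j + 2) : ℕ) =
      3 / 20 * ((1 - r) * r ^ L * (1 - q)) * (q / 2) ^ j := by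
    intro j
    rw [levelMesh, levelWeight, levelCapital, div_pow]
    push_cast
    field_simp
    ring
  have h1 := sub_pos.2 hr
  have h2 := sub_pos.2 hq
  have hsum := (hasSum_geometric_of_lt_one (r := q / 2) (by positivity) (by linarith)).mul_left
    (3 / 20 * ((1 - r) * r ^ L * (1 - q)))
  simp only [hterm]
  rw [← ENNReal.ofReal_tsum_of_nonneg (fun j => by positivity) hsum.summable, hsum.tsum_eq]
  refine ENNReal.ofReal_le_ofReal ?_
  rw [mul_inv_le_iff₀ (by linarith)]
  have h3 : (1 - r) * r ^ L ≤ 1 :=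
    mul_le_one₀ (by linarith) (by positivity) (pow_le_one₀ hr0.le hr.le)
  have h4 : (1 - r) * r ^ L * (1 - q) ≤ 1 * (1 - q) := mul_le_mul_of_nonneg_right h3 h2.le
  linarith

theorem variationCoeff_mul_pVar_le {T : ℝ} (hT : 0 ≤ T) {ε δ : ℝ} (hε : 0 < ε) (hδ : 0 < δ) {L : ℕ}
    {ω : PricePath T} (hω : ∀ t, ω t ≤ 2 ^ L) :
    ENNReal.ofReal (variationCoeff ε δ L) * pVar (2 + ε) ω ≤
      variationCapital hT ε δ ⟨T, right_mem_Icc.2 hT⟩ ω + ENNReal.ofReal (3 / 20) := by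
  simp only [pVar, ENNReal.mul_iSup]
  refine iSup_le fun n => iSup_le fun t => iSup_le fun ⟨_, hmono, _, htn⟩ => ?_
  have htn' : t n = ⟨T, right_mem_Icc.2 hT⟩ := Subtype.ext htn
  set cross : ℕ → ℕ → ℝ := fun i j => 3 / 10 * levelMesh L j * levelWeight ε δ L j *
    crossCount (levelMesh L j) (2 ^ (j + 2)) (ω (t i)) (ω (t (i + 1)))
  have hcross : ∀ i j, 0 ≤ cross i j := fun i j => by
    have := levelMesh_pos L j
    have := levelWeight_pos hε hδ L j
    have := crossCount_nonneg (levelMesh L j) (2 ^ (j + 2)) (ω (t i)) (ω (t (i + 1)))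
    positivity
  calc ENNReal.ofReal (variationCoeff ε δ L) *
        ∑ i ∈ Finset.range n, ENNReal.ofReal (|ω (t (i + 1)) - ω (t i)| ^ (2 + ε))
      ≤ ∑ i ∈ Finset.range n, ∑' j, ENNReal.ofReal (cross i j) := by
        rw [Finset.mul_sum]
        refine Finset.sum_le_sum fun i _ => ?_
        obtain ⟨j, hj⟩ := exists_variationCoeff_mul_le hε hδ L (ω.nonneg' (t i))
          (ω.nonneg' (t (i + 1))) (hω _) (hω _)
        rw [← ENNReal.ofReal_mul (variationCoeff_pos hε hδ L).le]
        exact (ENNReal.ofReal_le_ofReal hj).trans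
          (ENNReal.le_tsum (f := fun j => ENNReal.ofReal (cross i j)) j)
    _ = ∑' j, ENNReal.ofReal (∑ i ∈ Finset.range n, cross i j) := by
        rw [← Summable.tsum_finsetSum fun _ _ => ENNReal.summable]
        exact tsum_congr fun j => (ENNReal.ofReal_sum_of_nonneg fun i _ => hcross i j).symm
    _ ≤ ∑' j, (ENNReal.ofReal ((levelStrategy hT ε δ L j).capital ⟨T, right_mem_Icc.2 hT⟩ ω) +
          ENNReal.ofReal
            (3 / 10 * levelMesh L j * levelWeight ε δ L j * (2 ^ (j + 2) : ℕ))) := by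
        refine ENNReal.tsum_le_tsum fun j => ?_
        refine le_trans (ENNReal.ofReal_le_ofReal ?_) ENNReal.ofReal_add_le
        rw [← Finset.mul_sum, ← htn']
        exact crossCount_le_gridStrategy_capital hT (levelWeight_pos hε hδ L j).le
          (levelMesh_pos L j) (2 ^ (j + 2)) ω hmono n
    _ ≤ _ := by
        rw [ENNReal.tsum_add]
        exact add_le_add (tsum_levelStrategy_le hT ε δ L _ ω) (tsum_levelCost_le hε hδ L)

theorem le_variationCoeff {ε δ : ℝ} (hε : 0 < ε) (hδ : 0 < δ) {L : ℕ} {x : ℝ} (hx : 1 ≤ x)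
    (hL : (2 : ℝ) ^ L ≤ 2 * x) :
    (1 - (2 : ℝ) ^ (-ε)) * (1 - (2 : ℝ) ^ (-δ)) * (2 : ℝ) ^ (-6 - ε - δ) / x ^ (2 + ε + δ) ≤
      variationCoeff ε δ L := by
  have h1 := sub_pos.2 (two_rpow_neg_lt_one hε)
  have h2 := sub_pos.2 (two_rpow_neg_lt_one hδ)
  have hx0 : 0 < x := by linarith
  have hr : ((2 : ℝ) ^ (-δ)) ^ L = (((2 : ℝ) ^ L) ^ δ)⁻¹ := by
    rw [← Real.rpow_neg (by positivity), ← Real.rpow_natCast, ← Real.rpow_natCast,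
      ← Real.rpow_mul zero_le_two, ← Real.rpow_mul zero_le_two, mul_comm]
  have e1 : variationCoeff ε δ L =
      (1 - (2 : ℝ) ^ (-ε)) * (1 - (2 : ℝ) ^ (-δ)) * (1 / (16 * ((2 : ℝ) ^ L) ^ (2 + ε + δ))) := by
    rw [variationCoeff, hr, Real.rpow_add (by positivity) (2 + ε) δ]
    field_simp
  have e2 : (2 : ℝ) ^ (-6 - ε - δ) / x ^ (2 + ε + δ) = 1 / (16 * (2 * x) ^ (2 + ε + δ)) := by
    rw [Real.mul_rpow zero_le_two hx0.le, show -6 - ε - δ = -(4 + (2 + ε + δ)) by ring,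
      Real.rpow_neg zero_le_two, Real.rpow_add two_pos 4]
    norm_num
    ring
  rw [e1, mul_div_assoc, e2]
  have e3 : ((2 : ℝ) ^ L) ^ (2 + ε + δ) ≤ (2 * x) ^ (2 + ε + δ) :=
    Real.rpow_le_rpow (by positivity) hL (by linarith)
  gcongr

theorem mainTheorem6 (T : ℝ) (hT : 0 ≤ T) (ε : ℝ) (hε : 0 < ε) (δ : ℝ) (hδ : 0 < δ) :
    ∃ S : Icc (0 : ℝ) T → PricePath T → EReal,
      IsPositiveCapitalProcess S ∧
      (∀ ω, S ⟨0, left_mem_Icc.2 hT⟩ ω = 1) ∧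
      ∀ ω : PricePath T,
        (pVar (2 + ε) ω ≠ ∞ →
          (((1 - (2 : ℝ) ^ (-ε)) * (1 - (2 : ℝ) ^ (-δ)) * (2 : ℝ) ^ (-6 - ε - δ) *
              ((pVar (2 + ε) ω).toReal / (max 1 ω.sup) ^ (2 + ε + δ)) - 1 / 4 : ℝ) : EReal)
            < S ⟨T, right_mem_Icc.2 hT⟩ ω) ∧
        (pVar (2 + ε) ω = ∞ → S ⟨T, right_mem_Icc.2 hT⟩ ω = ⊤) := by
  refine ⟨fun t ω => (variationCapital hT ε δ t ω : EReal),
    isPositiveCapitalProcess_variationCapital hT hε hδ, fun ω => ?_, fun ω => ?_⟩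
  · simp only [variationCapital_zero hT hε hδ, EReal.coe_ennreal_one]
  -- `L = l + 1` satisfies `1 ∨ sup ω < 2 ^ L ≤ 2 * (1 ∨ sup ω)`.
  obtain ⟨l, hl1, hl2⟩ := exists_nat_pow_near (le_max_left 1 ω.sup) one_lt_two
  have hω : ∀ t, ω t ≤ 2 ^ (l + 1) := fun t =>
    (le_ciSup ω.bddAbove_range t).trans ((le_max_right 1 ω.sup).trans hl2.le)
  have key := variationCoeff_mul_pVar_le hT hε hδ hω
  have hB := variationCoeff_pos hε hδ (l + 1)
  constructor
  · intro hfin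
    by_cases hS : variationCapital hT ε δ ⟨T, right_mem_Icc.2 hT⟩ ω = ∞
    · simp only [hS, EReal.coe_ennreal_top]
      exact EReal.coe_lt_top _
    · have h1 := ENNReal.toReal_mono (ENNReal.add_ne_top.2 ⟨hS, ENNReal.ofReal_ne_top⟩) key
      rw [ENNReal.toReal_mul, ENNReal.toReal_ofReal hB.le,
        ENNReal.toReal_add hS ENNReal.ofReal_ne_top, ENNReal.toReal_ofReal (by norm_num)] at h1
      have h2 := mul_le_mul_of_nonneg_right (le_variationCoeff hε hδ (L := l + 1)
        (le_max_left 1 ω.sup) (by rw [pow_succ]; linarith))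
        (ENNReal.toReal_nonneg (a := pVar (2 + ε) ω))
      rw [div_mul_eq_mul_div, mul_div_assoc] at h2
      beta_reduce
      rw [← EReal.coe_ennreal_toReal hS, EReal.coe_lt_coe_iff]
      linarith
  · intro hinf
    rw [hinf, ENNReal.mul_top (ENNReal.ofReal_pos.2 hB).ne', top_le_iff,
      ENNReal.add_eq_top] at key
    simp only [key.resolve_right ENNReal.ofReal_ne_top, EReal.coe_ennreal_top]
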